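/- Let $m\ge n\ge 1$ be integers and let $\beta>1$ be the (unique) zero greater than $1$ of $x^3-mx^2-mx-n$. Put $\ell=-\frac{\beta}{\beta+1}$ and $T(x)=-\beta x-\lfloor-\beta x-\ell\rfloor$. For $x\in[\ell,\ell+1)$ let $d(x)=x_1x_2x_3\cdots$ with $x_i=\lfloor-\beta T^{i-1}(x)-\ell\rfloor$. For $x\in\mathbb R$ let $k\ge0$ be the least integer with $x/(-\beta)^k\in(\ell,\ell+1)$ and write $d\big(x/(-\beta)^k\big)=x_1x_2x_3\cdots$; the (Ito–Sadahiro) $(-\beta)$-expansion of $x$ is $x_1\cdots x_k\bullet x_{k+1}x_{k+2}\cdots$ (and $0\bullet x_1x_2\cdots$ if $k=0$), so that the digit $x_i$ stands at the power $(-\beta)^{k-i}$. Let $\mathrm{Fin}(-\beta)$ be the set of $x\in\mathbb R$ whose $(-\beta)$-expansion has only finitely many nonzero digits. Then $\mathrm{Fin}(-\beta)$ is a ring (a subring of $\mathbb R$) if and only if $n=m$. -/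

import Mathlib

noncomputable section

namespace NegativeBase

/-- The left end point `ℓ = -β / (β + 1)` of the unit interval `[ℓ, ℓ + 1)`. -/
def leftEnd (β : ℝ) : ℝ := -β / (β + 1)

/-- The Ito–Sadahiro transformation `T(x) = -β x - ⌊-β x - ℓ⌋`. -/
def T (β x : ℝ) : ℝ := -β * x - (⌊-β * x - leftEnd β⌋ : ℝ)

/-- The digits of `d(x) = x₁ x₂ x₃ ⋯` for `x ∈ [ℓ, ℓ + 1)`, indexed from `0`:
`digit β x i` is `x_{i+1} = ⌊-β T^i(x) - ℓ⌋`. -/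
def digit (β x : ℝ) (i : ℕ) : ℤ := ⌊-β * (T β)^[i] x - leftEnd β⌋

/-- The least `k ≥ 0` with `x / (-β)^k ∈ (ℓ, ℓ + 1)`. -/
def scale (β x : ℝ) : ℕ :=
  sInf {k : ℕ | x / (-β) ^ k ∈ Set.Ioo (leftEnd β) (leftEnd β + 1)}

/-- For `β > 1` a suitable `k` exists, so `scale` is a genuine minimum. -/
theorem scale_spec {β : ℝ} (hβ : 1 < β) (x : ℝ) :
    x / (-β) ^ scale β x ∈ Set.Ioo (leftEnd β) (leftEnd β + 1) := by
  have hl : leftEnd β < 0 := div_neg_of_neg_of_pos (by linarith) (by linarith)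
  have hr : 0 < leftEnd β + 1 := by
    have h : leftEnd β + 1 = 1 / (β + 1) := by
      unfold leftEnd
      field_simp
      ring
    rw [h]
    positivity
  have hlim : Filter.Tendsto (fun k : ℕ => x / (-β) ^ k) Filter.atTop (nhds 0) := by
    have h1 : |(-β)⁻¹| < 1 := by
      rw [abs_inv, abs_neg, abs_of_pos (by linarith)]
      exact inv_lt_one_of_one_lt₀ hβ
    have h2 := (tendsto_pow_atTop_nhds_zero_of_abs_lt_one h1).const_mul x
    simpa only [div_eq_mul_inv, inv_pow, mul_zero] using h2
  have hne : {k : ℕ | x / (-β) ^ k ∈ Set.Ioo (leftEnd β) (leftEnd β + 1)}.Nonempty :=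
    (hlim.eventually (Ioo_mem_nhds hl hr)).exists
  exact Nat.sInf_mem hne

/-- The `(-β)`-expansion `⟨x⟩` of a real number `x`, as the family of its digits:
`expansion β x j` is the digit at the power `(-β)^j`. With `k = scale β x` and
`d(x / (-β)^k) = x₁ x₂ x₃ ⋯`, the digit at `(-β)^j` is `x_{k-j}` for `j < k`, and `0` for
`j ≥ k`. -/
def expansion (β x : ℝ) (j : ℤ) : ℤ :=
  if j < (scale β x : ℤ) then
    digit β (x / (-β) ^ scale β x) ((scale β x : ℤ) - 1 - j).toNat
  else 0

/-- `Fin(-β)`: the real numbers whose `(-β)`-expansion has only finitely many nonzero digits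
after the fractional point. -/
def FinExp (β : ℝ) : Set ℝ :=
  {x : ℝ | ∃ N : ℕ, ∀ j : ℤ, j < -(N : ℤ) → expansion β x j = 0}

end NegativeBase

end

noncomputable section

namespace NegativeBase

variable {β : ℝ}

theorem leftEnd_eq (hβ : 1 < β) : leftEnd β = 1 / (β + 1) - 1 := by
  unfold leftEnd
  have : β + 1 ≠ 0 := by linarith
  field_simp
  ring

theorem inv_add_one_pos (hβ : 1 < β) : 0 < 1 / (β + 1) := by
  have : 0 < β + 1 := by linarith
  positivity

theorem inv_add_one_lt (hβ : 1 < β) : 1 / (β + 1) < 1 / 2 :=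
  one_div_lt_one_div_of_lt (by norm_num) (by linarith)

theorem T_mem (β x : ℝ) : T β x ∈ Set.Ico (leftEnd β) (leftEnd β + 1) := by
  have h1 := Int.floor_le (-β * x - leftEnd β)
  have h2 := Int.lt_floor_add_one (-β * x - leftEnd β)
  constructor <;> unfold T <;> linarith

/-- `T x` is the only representative of `-β x` modulo `1` in `[ℓ, ℓ + 1)`. -/
theorem T_eq_of_mem {x y : ℝ} (k : ℤ) (h : -β * x - k = y)
    (hy : y ∈ Set.Ico (leftEnd β) (leftEnd β + 1)) : T β x = y := by
  have : ⌊-β * x - leftEnd β⌋ = k := by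
    rw [Int.floor_eq_iff]
    constructor <;> linarith [hy.1, hy.2]
  rw [T, this, h]

theorem zero_mem_Ioo (hβ : 1 < β) : (0 : ℝ) ∈ Set.Ioo (leftEnd β) (leftEnd β + 1) := by
  have h1 := inv_add_one_pos hβ
  have h2 := inv_add_one_lt hβ
  rw [leftEnd_eq hβ]
  constructor <;> linarith

theorem T_zero (hβ : 1 < β) : T β 0 = 0 :=
  T_eq_of_mem 0 (by simp) (Set.Ioo_subset_Ico_self (zero_mem_Ioo hβ))

theorem iterate_T_mem {x : ℝ} (hx : x ∈ Set.Ico (leftEnd β) (leftEnd β + 1)) (k : ℕ) :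
    (T β)^[k] x ∈ Set.Ico (leftEnd β) (leftEnd β + 1) := by
  cases k with
  | zero => exact hx
  | succ k => rw [Function.iterate_succ_apply']; exact T_mem _ _

theorem iterate_T_zero (hβ : 1 < β) (k : ℕ) : (T β)^[k] 0 = 0 :=
  Function.iterate_fixed (T_zero hβ) k

theorem digit_zero (hβ : 1 < β) (k : ℕ) : digit β 0 k = 0 := by
  have h := zero_mem_Ioo hβ
  rw [digit, iterate_T_zero hβ, Int.floor_eq_iff]
  constructor <;> push_cast <;> linarith [h.1, h.2]

theorem iterate_T_succ (β x : ℝ) (i : ℕ) :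
    (T β)^[i + 1] x = -β * (T β)^[i] x - digit β x i := by
  rw [Function.iterate_succ_apply']; rfl

/-- The orbit of `x` under `T` reaches `0`. -/
def Terminates (β x : ℝ) : Prop := ∃ N : ℕ, (T β)^[N] x = 0

theorem Terminates.of_T {x : ℝ} (h : Terminates β (T β x)) : Terminates β x := by
  obtain ⟨N, hN⟩ := h
  exact ⟨N + 1, by rw [Function.iterate_succ_apply, hN]⟩

theorem Terminates.of_iterate {x : ℝ} (k : ℕ) (h : Terminates β ((T β)^[k] x)) :
    Terminates β x := by
  obtain ⟨N, hN⟩ := h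
  exact ⟨N + k, by rw [Function.iterate_add_apply, hN]⟩

theorem Terminates.T {x : ℝ} (hβ : 1 < β) (h : Terminates β x) : Terminates β (T β x) := by
  obtain ⟨N, hN⟩ := h
  exact ⟨N, by rw [← Function.iterate_succ_apply, Function.iterate_succ_apply', hN, T_zero hβ]⟩

theorem div_neg_mem {y : ℝ} (hβ : 1 < β) (hy : y ∈ Set.Ioo (leftEnd β) (leftEnd β + 1)) :
    y / (-β) ∈ Set.Ioo (leftEnd β) (leftEnd β + 1) ∧ NegativeBase.T β (y / (-β)) = y := by
  have hT : NegativeBase.T β (y / (-β)) = y := by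
    refine T_eq_of_mem 0 ?_ (Set.Ioo_subset_Ico_self hy)
    have : β ≠ 0 := by linarith
    push_cast
    field_simp
    ring
  refine ⟨?_, hT⟩
  have hb : 0 < β := by linarith
  have hl : leftEnd β = -(β * (1 / (β + 1))) := by unfold leftEnd; field_simp
  have hl' := leftEnd_eq hβ
  have hg := inv_add_one_pos hβ
  have hg' := inv_add_one_lt hβ
  obtain ⟨h1, h2⟩ := hy
  rw [show y / (-β) = (-y) / β by rw [div_neg, neg_div], Set.mem_Ioo, lt_div_iff₀ hb, div_lt_iff₀ hb]
  generalize 1 / (β + 1) = g at *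
  constructor <;> nlinarith

theorem terminates_div_pow {y : ℝ} (hβ : 1 < β)
    (hy : y ∈ Set.Ioo (leftEnd β) (leftEnd β + 1)) (k : ℕ) :
    y / (-β) ^ k ∈ Set.Ioo (leftEnd β) (leftEnd β + 1) ∧
      (Terminates β (y / (-β) ^ k) ↔ Terminates β y) := by
  induction k with
  | zero => simpa using hy
  | succ k ih =>
    obtain ⟨h1, h2⟩ := ih
    obtain ⟨h3, h4⟩ := div_neg_mem hβ h1
    rw [pow_succ, ← div_div]
    refine ⟨h3, ?_⟩
    rw [← h2]
    constructor
    · intro h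
      rw [← h4]
      exact h.T hβ
    · intro h
      rw [← h4] at h
      exact h.of_T

theorem mem_finExp_iff_scale (hβ : 1 < β) (x : ℝ) :
    x ∈ FinExp β ↔ Terminates β (x / (-β) ^ scale β x) := by
  have hy := Set.Ioo_subset_Ico_self (scale_spec hβ x)
  set y := x / (-β) ^ scale β x with hydef
  constructor
  · rintro ⟨N, hN⟩
    have hd : ∀ i, digit β y (scale β x + N + i) = 0 := by
      intro i
      have := hN ((scale β x : ℤ) - 1 - (scale β x + N + i : ℕ)) (by push_cast; omega)
      rw [expansion, if_pos (by push_cast; omega)] at this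
      rw [← this]
      congr 1
      push_cast
      omega
    set M := scale β x + N with hM
    have hpow : ∀ i, (T β)^[M + i] y = (-β) ^ i * (T β)^[M] y := by
      intro i
      induction i with
      | zero => simp
      | succ i ih => rw [← add_assoc, iterate_T_succ, hd i, ih]; push_cast; ring
    refine ⟨M, ?_⟩
    by_contra hne
    have hpos : 0 < |(T β)^[M] y| := abs_pos.mpr hne
    obtain ⟨i, hi⟩ := pow_unbounded_of_one_lt (1 / |(T β)^[M] y|) hβ
    rw [div_lt_iff₀ hpos] at hi
    have hb := iterate_T_mem hy (M + i)
    have habs : |(T β)^[M + i] y| ≤ 1 := by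
      have h0 := zero_mem_Ioo hβ
      rw [abs_le]
      constructor <;> linarith [hb.1, hb.2, h0.1, h0.2]
    rw [hpow, abs_mul, abs_pow, abs_neg, abs_of_pos (by linarith : (0 : ℝ) < β)] at habs
    linarith
  · rintro ⟨N, hN⟩
    refine ⟨N, fun j hj => ?_⟩
    rw [expansion]
    split_ifs with h
    · rw [← hydef]
      obtain ⟨i, hi⟩ : ∃ i : ℕ, ((scale β x : ℤ) - 1 - j).toNat = i + N :=
        ⟨((scale β x : ℤ) - 1 - j).toNat - N, by omega⟩
      rw [hi, digit, Function.iterate_add_apply, hN]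
      exact digit_zero hβ i
    · rfl

theorem mem_finExp_iff (hβ : 1 < β) {x : ℝ} {k : ℕ}
    (hk : x / (-β) ^ k ∈ Set.Ioo (leftEnd β) (leftEnd β + 1)) :
    x ∈ FinExp β ↔ Terminates β (x / (-β) ^ k) := by
  have hle : scale β x ≤ k := Nat.sInf_le hk
  obtain ⟨j, rfl⟩ := Nat.exists_eq_add_of_le hle
  rw [mem_finExp_iff_scale hβ, pow_add, ← div_div]
  exact (terminates_div_pow hβ (scale_spec hβ x) j).2.symm

theorem div_mem_finExp (hβ : 1 < β) {x : ℝ} (hx : x ∈ FinExp β) : x / (-β) ∈ FinExp β := by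
  have hs := scale_spec hβ x
  have h1 := terminates_div_pow hβ hs 1
  rw [pow_one] at h1
  have he : x / (-β) / (-β) ^ scale β x = x / (-β) ^ scale β x / (-β) := div_right_comm _ _ _
  rw [mem_finExp_iff hβ (k := scale β x) (he ▸ h1.1), he, h1.2]
  exact (mem_finExp_iff_scale hβ x).1 hx

/-- The fixed point `-(n + 1) / (β + 1)` of `T` has an infinite expansion when `n + 1 < β`. -/
theorem neg_div_not_mem_finExp (hβ : 1 < β) {n : ℕ} (hn : (n : ℝ) + 1 < β) :
    -((n + 1 : ℝ) / (β + 1)) ∉ FinExp β := by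
  have hb : 0 < β + 1 := by linarith
  have hpos : 0 < (n + 1 : ℝ) / (β + 1) := by positivity
  set x : ℝ := -((n + 1 : ℝ) / (β + 1)) with hx
  have hmem : x ∈ Set.Ioo (leftEnd β) (leftEnd β + 1) := by
    constructor
    · rw [hx, leftEnd, neg_div, neg_lt_neg_iff]
      exact div_lt_div_of_pos_right hn hb
    · have := zero_mem_Ioo hβ
      linarith [this.2]
  have hT : T β x = x := by
    refine T_eq_of_mem (n + 1 : ℤ) ?_ (Set.Ioo_subset_Ico_self hmem)
    rw [hx]
    push_cast
    field_simp
    ring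
  have h0 : x / (-β) ^ 0 ∈ Set.Ioo (leftEnd β) (leftEnd β + 1) := by simpa using hmem
  rw [mem_finExp_iff hβ h0]
  rintro ⟨N, hN⟩
  rw [pow_zero, div_one, Function.iterate_fixed hT] at hN
  linarith

theorem eq_of_finExp_subring {m n : ℕ} (hmn : n ≤ m) (hβ : 1 < β)
    (hroot : β ^ 3 - (m : ℝ) * β ^ 2 - (m : ℝ) * β - (n : ℝ) = 0) (S : Subring ℝ)
    (hS : (S : Set ℝ) = FinExp β) : n = m := by
  by_contra hne
  have hlt : n + 1 ≤ m := by omega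
  have hlt' : (n : ℝ) + 1 ≤ m := by exact_mod_cast hlt
  have hb : 0 < β := by linarith
  have hmβ : (m : ℝ) < β := by
    by_contra! h
    have hn0 : (0 : ℝ) ≤ n := Nat.cast_nonneg n
    have : β ^ 2 * (β - m) ≤ 0 := mul_nonpos_of_nonneg_of_nonpos (by positivity) (by linarith)
    nlinarith [mul_pos (lt_of_lt_of_le hb h) hb]
  have hmem : ∀ x, x ∈ S ↔ x ∈ FinExp β := fun x => by rw [← hS]; rfl
  have hinv : β⁻¹ ∈ S := by
    have h := (hmem _).2 (div_mem_finExp hβ ((hmem _).1 S.one_mem))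
    have h' := S.neg_mem h
    rwa [div_neg, neg_neg, one_div] at h'
  apply neg_div_not_mem_finExp hβ (by linarith : (n : ℝ) + 1 < β)
  rw [← hmem]
  have hexpr : -((n + 1 : ℝ) / (β + 1)) =
      (m : ℝ) * β⁻¹ + (n : ℝ) * (β⁻¹ * β⁻¹) - (n : ℝ) * β⁻¹ - 1 := by
    have h1 : β + 1 ≠ 0 := by linarith
    field_simp
    linear_combination hroot
  rw [hexpr]
  exact S.sub_mem (S.sub_mem (S.add_mem (S.mul_mem (natCast_mem S m) hinv)
    (S.mul_mem (natCast_mem S n) (S.mul_mem hinv hinv))) (S.mul_mem (natCast_mem S n) hinv))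
    S.one_mem

/-! ### The case `n = m` -/

/-- The element of `ℤ[β]` with coordinates `a, b, c` in the basis `1, m - β, β² - mβ - m`. -/
def val (m : ℕ) (β : ℝ) (a b c : ℤ) : ℝ := a - b * (β - m) + c * (β ^ 2 - m * β - m)

theorem neg_mul_val {m : ℕ} (hroot : β ^ 3 - (m : ℝ) * β ^ 2 - (m : ℝ) * β - (m : ℝ) = 0)
    (a b c k : ℤ) : -β * val m β a b c - k = val m β (-(a * m) + b * m - c * m - k) a b := by
  unfold val
  push_cast
  linear_combination (-(c : ℝ)) * hroot

theorem exists_T_val {m : ℕ} (hroot : β ^ 3 - (m : ℝ) * β ^ 2 - (m : ℝ) * β - (m : ℝ) = 0)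
    (a b c : ℤ) : ∃ k, T β (val m β a b c) = val m β k a b :=
  ⟨_, neg_mul_val hroot a b c _⟩

theorem exists_val_mem (m : ℕ) (β : ℝ) (b c : ℤ) :
    ∃ a, val m β a b c ∈ Set.Ico (leftEnd β) (leftEnd β + 1) := by
  refine ⟨-⌊val m β 0 b c - leftEnd β⌋, ?_⟩
  have h1 := Int.floor_le (val m β 0 b c - leftEnd β)
  have h2 := Int.lt_floor_add_one (val m β 0 b c - leftEnd β)
  have h3 : val m β (-⌊val m β 0 b c - leftEnd β⌋) b c =
      val m β 0 b c - ⌊val m β 0 b c - leftEnd β⌋ := by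
    unfold val; push_cast; ring
  rw [h3]
  constructor <;> linarith

structure Bounds (g l u : ℝ) : Prop where
  g_pos : 0 < g
  g_lt : g < 1 / 2
  u_lt : u < l
  l_lt : l < 1
  sub_lt : l - u < g
  g_le : g ≤ 1 - u
  g_le_u : g ≤ u
  one_sub_lt : 1 - l < g

theorem bounds {m : ℕ} (hm : 1 ≤ m) (hβ : 1 < β)
    (hroot : β ^ 3 - (m : ℝ) * β ^ 2 - (m : ℝ) * β - (m : ℝ) = 0) :
    Bounds (1 / (β + 1)) (β - m) (β ^ 2 - m * β - m) := by
  have hb : 0 < β := by linarith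
  have hb1 : 0 < β + 1 := by linarith
  have hD : 0 < 1 + β + β ^ 2 := by positivity
  have hm' : (1 : ℝ) ≤ m := by exact_mod_cast hm
  have hmD : (m : ℝ) = β ^ 3 / (1 + β + β ^ 2) := by
    rw [eq_div_iff hD.ne']; linear_combination -hroot
  have hl : β - m = (β + β ^ 2) / (1 + β + β ^ 2) := by
    rw [hmD]; field_simp; ring
  have hu : β ^ 2 - m * β - m = β ^ 2 / (1 + β + β ^ 2) := by
    rw [hmD]; field_simp; ring
  have h3 : 1 + β + β ^ 2 ≤ β ^ 3 := by nlinarith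
  have hl' : 1 - (β + β ^ 2) / (1 + β + β ^ 2) = 1 / (1 + β + β ^ 2) := by field_simp; ring
  have hu' : 1 - β ^ 2 / (1 + β + β ^ 2) = (1 + β) / (1 + β + β ^ 2) := by field_simp; ring
  refine ⟨inv_add_one_pos hβ, inv_add_one_lt hβ, ?_, ?_, ?_, ?_, ?_, ?_⟩
  · rw [hl, hu]; exact div_lt_div_of_pos_right (by linarith) hD
  · rw [hl, div_lt_one hD]; linarith
  · rw [hl, hu, ← sub_div, div_lt_div_iff₀ hD hb1]; nlinarith
  · rw [hu, hu', div_le_div_iff₀ hb1 hD]; nlinarith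
  · rw [hu, div_le_div_iff₀ hb1 hD]; nlinarith
  · rw [hl, hl', div_lt_div_iff₀ hD hb1]; nlinarith

/-- Every point of `[ℓ, ℓ + 1)` with last two coordinates `b, c` has a terminating orbit. -/
def StateTerminates (m : ℕ) (β : ℝ) (b c : ℤ) : Prop :=
  ∀ a, val m β a b c ∈ Set.Ico (leftEnd β) (leftEnd β + 1) → Terminates β (val m β a b c)

theorem StateTerminates.prev {m : ℕ}
    (hroot : β ^ 3 - (m : ℝ) * β ^ 2 - (m : ℝ) * β - (m : ℝ) = 0) {a b c : ℤ}
    (h : StateTerminates m β a b)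
    (huniq : ∀ k, val m β k b c ∈ Set.Ico (leftEnd β) (leftEnd β + 1) → k = a) :
    StateTerminates m β b c := by
  intro k hk
  obtain rfl := huniq k hk
  obtain ⟨k', hk'⟩ := exists_T_val hroot k b c
  apply Terminates.of_T
  rw [hk']
  exact h k' (hk' ▸ T_mem _ _)

theorem int_eq_of_lt {k a : ℤ} (h1 : (a : ℝ) - 1 < k) (h2 : (k : ℝ) < a + 1) : k = a := by
  have h1' : a - 1 < k := by exact_mod_cast h1
  have h2' : k < a + 1 := by exact_mod_cast h2
  omega

/-- The witness states `(b, c)`, closed under differences of orbits of `T`. -/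
def Witness (b c : ℤ) : Prop :=
  (b = 0 ∧ c = 0) ∨ (b = 0 ∧ c = -1) ∨ (b = -1 ∧ c = -1) ∨ (b = -1 ∧ c = 0) ∨
    (b = 0 ∧ c = 1) ∨ (b = 1 ∧ c = 1) ∨ (b = 1 ∧ c = 0)

theorem Witness.stateTerminates {m : ℕ} (hm : 1 ≤ m) (hβ : 1 < β)
    (hroot : β ^ 3 - (m : ℝ) * β ^ 2 - (m : ℝ) * β - (m : ℝ) = 0) {b c : ℤ}
    (h : Witness b c) : StateTerminates m β b c := by
  obtain ⟨g1, g2, g3, g4, g5, g6, g7, g8⟩ := bounds hm hβ hroot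
  have hl := leftEnd_eq hβ
  have h00 : StateTerminates m β 0 0 := by
    intro a ha
    have : a = 0 := by
      obtain ⟨i1, i2⟩ := ha
      simp only [val] at i1 i2
      push_cast at i1 i2
      apply int_eq_of_lt <;> push_cast <;> linarith
    subst this
    exact ⟨0, by simp [val]⟩
  have h1 : StateTerminates m β 0 (-1) := by
    refine h00.prev hroot fun k hk => ?_
    obtain ⟨i1, i2⟩ := hk
    simp only [val] at i1 i2
    push_cast at i1 i2
    apply int_eq_of_lt <;> push_cast <;> linarith
  have h2 : StateTerminates m β (-1) (-1) := by
    refine h1.prev hroot fun k hk => ?_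
    obtain ⟨i1, i2⟩ := hk
    simp only [val] at i1 i2
    push_cast at i1 i2
    apply int_eq_of_lt <;> push_cast <;> linarith
  have h3 : StateTerminates m β (-1) 0 := by
    refine h2.prev hroot fun k hk => ?_
    obtain ⟨i1, i2⟩ := hk
    simp only [val] at i1 i2
    push_cast at i1 i2
    apply int_eq_of_lt <;> push_cast <;> linarith
  have h4 : StateTerminates m β 0 1 := by
    refine h3.prev hroot fun k hk => ?_
    obtain ⟨i1, i2⟩ := hk
    simp only [val] at i1 i2
    push_cast at i1 i2
    apply int_eq_of_lt <;> push_cast <;> linarith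
  have h5 : StateTerminates m β 1 1 := by
    refine h4.prev hroot fun k hk => ?_
    obtain ⟨i1, i2⟩ := hk
    simp only [val] at i1 i2
    push_cast at i1 i2
    apply int_eq_of_lt <;> push_cast <;> linarith
  have h6 : StateTerminates m β 1 0 := by
    refine h5.prev hroot fun k hk => ?_
    obtain ⟨i1, i2⟩ := hk
    simp only [val] at i1 i2
    push_cast at i1 i2
    apply int_eq_of_lt <;> push_cast <;> linarith
  rcases h with ⟨rfl, rfl⟩ | ⟨rfl, rfl⟩ | ⟨rfl, rfl⟩ | ⟨rfl, rfl⟩ | ⟨rfl, rfl⟩ | ⟨rfl, rfl⟩ |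
    ⟨rfl, rfl⟩ <;> assumption

theorem Witness.next {m : ℕ} (hm : 1 ≤ m) (hβ : 1 < β)
    (hroot : β ^ 3 - (m : ℝ) * β ^ 2 - (m : ℝ) * β - (m : ℝ) = 0) {a b c : ℤ}
    (h : Witness b c) (hv : |val m β a b c| < 1) : Witness a b := by
  obtain ⟨g1, g2, g3, g4, g5, g6, g7, g8⟩ := bounds hm hβ hroot
  have key : ∀ p q : ℤ, (p : ℝ) - 1 < a → (a : ℝ) < q + 1 → p ≤ a ∧ a ≤ q := by
    intro p q h1 h2
    have h1' : p - 1 < a := by exact_mod_cast h1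
    have h2' : a < q + 1 := by exact_mod_cast h2
    omega
  obtain ⟨i1, i2⟩ := abs_lt.1 hv
  unfold val at i1 i2
  unfold Witness
  rcases h with ⟨rfl, rfl⟩ | ⟨rfl, rfl⟩ | ⟨rfl, rfl⟩ | ⟨rfl, rfl⟩ | ⟨rfl, rfl⟩ | ⟨rfl, rfl⟩ |
    ⟨rfl, rfl⟩ <;> push_cast at i1 i2
  · have := key 0 0 (by push_cast; linarith) (by push_cast; linarith); omega
  · have := key 0 1 (by push_cast; linarith) (by push_cast; linarith); omega
  · have := key (-1) 0 (by push_cast; linarith) (by push_cast; linarith); omega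
  · have := key (-1) 0 (by push_cast; linarith) (by push_cast; linarith); omega
  · have := key (-1) 0 (by push_cast; linarith) (by push_cast; linarith); omega
  · have := key 0 1 (by push_cast; linarith) (by push_cast; linarith); omega
  · have := key 0 1 (by push_cast; linarith) (by push_cast; linarith); omega

/-- Points whose difference is a witness keep a witness as difference along their orbits. -/
theorem iterate_T_sub_witness {m : ℕ} (hm : 1 ≤ m) (hβ : 1 < β)
    (hroot : β ^ 3 - (m : ℝ) * β ^ 2 - (m : ℝ) * β - (m : ℝ) = 0) {x y : ℝ}
    (hx : x ∈ Set.Ico (leftEnd β) (leftEnd β + 1)) (hy : y ∈ Set.Ico (leftEnd β) (leftEnd β + 1))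
    (h : ∃ a b c, Witness b c ∧ y - x = val m β a b c) (N : ℕ) :
    ∃ a b c, Witness b c ∧ (T β)^[N] y - (T β)^[N] x = val m β a b c := by
  induction N with
  | zero => exact h
  | succ N ih =>
    obtain ⟨a, b, c, hw, he⟩ := ih
    have hx' := iterate_T_mem hx N
    have hy' := iterate_T_mem hy N
    have hlt : |val m β a b c| < 1 := by
      rw [← he, abs_lt]
      constructor <;> linarith [hx'.1, hx'.2, hy'.1, hy'.2]
    have hnext := neg_mul_val hroot a b c (digit β y N - digit β x N)
    refine ⟨_, a, b, hw.next hm hβ hroot hlt, Eq.trans ?_ hnext⟩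
    rw [iterate_T_succ, iterate_T_succ, ← he]
    push_cast
    ring

theorem StateTerminates.add {m : ℕ} (hm : 1 ≤ m) (hβ : 1 < β)
    (hroot : β ^ 3 - (m : ℝ) * β ^ 2 - (m : ℝ) * β - (m : ℝ) = 0) {b c b' c' : ℤ}
    (h : StateTerminates m β b c) (hw : Witness (b' - b) (c' - c)) :
    StateTerminates m β b' c' := by
  intro a' hy
  obtain ⟨a, hx⟩ := exists_val_mem m β b c
  obtain ⟨N, hN⟩ := h a hx
  obtain ⟨p, q, r, hw', he⟩ := iterate_T_sub_witness hm hβ hroot hx hy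
    ⟨a' - a, b' - b, c' - c, hw, by unfold val; push_cast; ring⟩ N
  rw [hN, sub_zero] at he
  apply Terminates.of_iterate N
  rw [he]
  exact hw'.stateTerminates hm hβ hroot p (he ▸ iterate_T_mem hy N)

theorem stateTerminates {m : ℕ} (hm : 1 ≤ m) (hβ : 1 < β)
    (hroot : β ^ 3 - (m : ℝ) * β ^ 2 - (m : ℝ) * β - (m : ℝ) = 0) (b c : ℤ) :
    StateTerminates m β b c := by
  have h0 : StateTerminates m β b 0 := by
    induction b using Int.induction_on with
    | zero => exact Witness.stateTerminates hm hβ hroot (by unfold Witness; omega)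
    | succ i ih => exact ih.add hm hβ hroot (by unfold Witness; omega)
    | pred i ih => exact ih.add hm hβ hroot (by unfold Witness; omega)
  induction c using Int.induction_on with
  | zero => exact h0
  | succ i ih => exact ih.add hm hβ hroot (by unfold Witness; omega)
  | pred i ih => exact ih.add hm hβ hroot (by unfold Witness; omega)

theorem exists_val_of_mem_closure {m : ℕ}
    (hroot : β ^ 3 - (m : ℝ) * β ^ 2 - (m : ℝ) * β - (m : ℝ) = 0) {x : ℝ}
    (hx : x ∈ Subring.closure {β}) : ∃ a b c, x = val m β a b c := by
  induction hx using Subring.closure_induction with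
  | mem x hx =>
    rw [Set.mem_singleton_iff] at hx
    exact ⟨m, -1, 0, by rw [hx, val]; push_cast; ring⟩
  | zero => exact ⟨0, 0, 0, by simp [val]⟩
  | one => exact ⟨1, 0, 0, by simp [val]⟩
  | add x y _ _ hx hy =>
    obtain ⟨a, b, c, rfl⟩ := hx
    obtain ⟨a', b', c', rfl⟩ := hy
    exact ⟨a + a', b + b', c + c', by unfold val; push_cast; ring⟩
  | neg x _ hx =>
    obtain ⟨a, b, c, rfl⟩ := hx
    exact ⟨-a, -b, -c, by unfold val; push_cast; ring⟩
  | mul x y _ _ hx hy =>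
    obtain ⟨a, b, c, rfl⟩ := hx
    obtain ⟨a', b', c', rfl⟩ := hy
    have h1 := neg_mul_val hroot a' b' c' 0
    obtain ⟨p, hp⟩ : ∃ p, -β * val m β a' b' c' = val m β p a' b' :=
      ⟨_, by rw [← h1]; push_cast; ring⟩
    have h2 := neg_mul_val hroot p a' b' 0
    obtain ⟨q, hq⟩ : ∃ q, -β * val m β p a' b' = val m β q p a' :=
      ⟨_, by rw [← h2]; push_cast; ring⟩
    have hq' : β * β * val m β a' b' c' = val m β q p a' := by
      rw [← hq, ← hp]; ring
    refine ⟨(a + b * m - c * m) * a' + (b + c * m) * p + c * q,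
      (a + b * m - c * m) * b' + (b + c * m) * a' + c * p,
      (a + b * m - c * m) * c' + (b + c * m) * b' + c * a', ?_⟩
    have : val m β a b c * val m β a' b' c' =
        (a + b * m - c * m) * val m β a' b' c' + (b + c * m) * val m β p a' b' +
          c * val m β q p a' := by
      rw [← hp, ← hq']
      rw [val]
      ring
    rw [this]
    unfold val
    push_cast
    ring

theorem exists_pow_mul_mem_closure (hβ : β ≠ 0) {x : ℝ} (hx : x ∈ Subring.closure {β⁻¹}) :
    ∃ k : ℕ, β ^ k * x ∈ Subring.closure {β} := by
  have hmem : β ∈ Subring.closure {β} := Subring.subset_closure rfl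
  induction hx using Subring.closure_induction with
  | mem x hx =>
    rw [Set.mem_singleton_iff] at hx
    exact ⟨1, by rw [hx, pow_one, mul_inv_cancel₀ hβ]; exact Subring.one_mem _⟩
  | zero => exact ⟨0, by simp⟩
  | one => exact ⟨0, by simp⟩
  | add x y _ _ hx hy =>
    obtain ⟨k, hk⟩ := hx
    obtain ⟨j, hj⟩ := hy
    refine ⟨k + j, ?_⟩
    rw [show β ^ (k + j) * (x + y) = β ^ j * (β ^ k * x) + β ^ k * (β ^ j * y) by ring]
    exact add_mem (mul_mem (pow_mem hmem _) hk) (mul_mem (pow_mem hmem _) hj)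
  | neg x _ hx =>
    obtain ⟨k, hk⟩ := hx
    exact ⟨k, by rw [mul_neg]; exact neg_mem hk⟩
  | mul x y _ _ hx hy =>
    obtain ⟨k, hk⟩ := hx
    obtain ⟨j, hj⟩ := hy
    refine ⟨k + j, ?_⟩
    rw [show β ^ (k + j) * (x * y) = (β ^ k * x) * (β ^ j * y) by ring]
    exact mul_mem hk hj

theorem iterate_T_mem_closure {k : ℕ} {x : ℝ} (hx : β ^ k * x ∈ Subring.closure {β}) :
    (T β)^[k] x ∈ Subring.closure {β} := by
  have hmem : β ∈ Subring.closure {β} := Subring.subset_closure rfl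
  induction k generalizing x with
  | zero => simpa using hx
  | succ k ih =>
    rw [Function.iterate_succ_apply]
    apply ih
    rw [T, show ∀ d : ℝ, β ^ k * (-β * x - d) = -(β ^ (k + 1) * x) - β ^ k * d by intro d; ring]
    exact sub_mem (neg_mem hx) (mul_mem (pow_mem hmem _) (intCast_mem _ _))

theorem mem_of_iterate_T_mem (hβ : β ≠ 0) (S : Subring ℝ) (hS : β⁻¹ ∈ S) {N : ℕ} {x : ℝ}
    (hx : (T β)^[N] x ∈ S) : x ∈ S := by
  induction N generalizing x with
  | zero => exact hx
  | succ N ih =>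
    have h := ih hx
    have hxe : x = -β⁻¹ * (T β x + ⌊-β * x - leftEnd β⌋) := by
      unfold T
      field_simp
      ring
    rw [hxe]
    exact mul_mem (neg_mem hS) (add_mem h (intCast_mem _ _))

/-- For `n = m`, the set `Fin(-β)` is `ℤ[β⁻¹]`. -/
theorem closure_inv_eq_finExp {m : ℕ} (hm : 1 ≤ m) (hβ : 1 < β)
    (hroot : β ^ 3 - (m : ℝ) * β ^ 2 - (m : ℝ) * β - (m : ℝ) = 0) :
    (Subring.closure {β⁻¹} : Set ℝ) = FinExp β := by
  have hb : β ≠ 0 := by linarith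
  have hinv : β⁻¹ ∈ Subring.closure {β⁻¹} := Subring.subset_closure rfl
  ext x
  have hs := scale_spec hβ x
  rw [SetLike.mem_coe, mem_finExp_iff_scale hβ]
  have hxe : x / (-β) ^ scale β x = x * (-β⁻¹) ^ scale β x := by
    rw [div_eq_mul_inv, ← inv_pow, inv_neg]
  constructor
  · intro hx
    have hy : x / (-β) ^ scale β x ∈ Subring.closure {β⁻¹} := by
      rw [hxe]
      exact mul_mem hx (pow_mem (neg_mem hinv) _)
    obtain ⟨k, hk⟩ := exists_pow_mul_mem_closure hb hy
    obtain ⟨a, b, c, he⟩ := exists_val_of_mem_closure hroot (iterate_T_mem_closure hk)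
    apply Terminates.of_iterate k
    rw [he]
    exact stateTerminates hm hβ hroot b c a
      (he ▸ iterate_T_mem (Set.Ioo_subset_Ico_self hs) k)
  · rintro ⟨N, hN⟩
    have hy := mem_of_iterate_T_mem hb _ hinv (hN ▸ zero_mem (Subring.closure {β⁻¹}))
    have hβmem : β ∈ Subring.closure {β⁻¹} := by
      have : β = m + m * β⁻¹ + m * (β⁻¹ * β⁻¹) := by
        field_simp
        linear_combination hroot
      have hmm := natCast_mem (Subring.closure {β⁻¹}) m
      have h := add_mem (add_mem hmm (mul_mem hmm hinv)) (mul_mem hmm (mul_mem hinv hinv))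
      rwa [← this] at h
    have hne : (-β) ^ scale β x ≠ 0 := pow_ne_zero _ (neg_ne_zero.2 hb)
    rw [← div_mul_cancel₀ x hne]
    exact mul_mem hy (pow_mem (neg_mem hβmem) _)

end NegativeBase

end

theorem theorem4 (m n : ℕ) (hn : 1 ≤ n) (hmn : n ≤ m) (β : ℝ) (hβ : 1 < β)
    (hroot : β ^ 3 - (m : ℝ) * β ^ 2 - (m : ℝ) * β - (n : ℝ) = 0) :
    (∃ S : Subring ℝ, (S : Set ℝ) = NegativeBase.FinExp β) ↔ n = m := by
  constructor
  · rintro ⟨S, hS⟩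
    exact NegativeBase.eq_of_finExp_subring hmn hβ hroot S hS
  · rintro rfl
    exact ⟨_, NegativeBase.closure_inv_eq_finExp hn hβ hroot⟩
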